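/- For an irrational $\alpha\in(0,1)$ let $\alpha_0=\alpha$, $a_{n+1}=\lceil 1/\alpha_n\rceil$, $\alpha_{n+1}=a_{n+1}-1/\alpha_n$ be its negative (round-up) continued fraction expansion, written $\alpha=[0;a_1,a_2,\dots]^-$, and put $D_{i-1}=\alpha_0\alpha_1\cdots\alpha_{i-1}$. The $\alpha$-expansion of $\gamma\in(0,1)$ is $\gamma=\sum_{i\ge1}\frac12(a_i-2+t_i)D_{i-1}$ with integers $-(a_i-2)\le t_i\le a_i$, $t_i\equiv a_i \pmod 2$, such that there is no $i$ with $t_i=a_i$ and $t_j=a_j-2$ for all $j>i$, and there are no $i$ and $\ell\ge1$ with $t_i=a_i$, $t_{i+\ell}=a_{i+\ell}$ and $t_j=a_j-2$ for all $i<j<i+\ell$. Let $$M(\alpha,\gamma)=\liminf_{|n|\to\infty}|n|\,\|n\alpha-\gamma\|,\qquad \rho(\alpha)=\sup_{\gamma\notin\mathbb Z+\mathbb Z\alpha}M(\alpha,\gamma),$$ where $n$ runs over the integers and $\|x\|$ is the distance from $x$ to the nearest integer. Let $R\ge3$ be an odd integer and $C(R)=\frac14\left(1-\frac1R\right)\left(1-\frac1{R^2}\right)$.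 For every integer $N\ge1$ there are an irrational $\alpha=[0;\overline{R,NR}]^-$ in $(0,1)$ and a $\gamma_*\in(0,1)$, $\gamma_*\notin\mathbb Z+\mathbb Z\alpha$, whose $\alpha$-expansion has the digits $t_i$ with period $-1,N$ (so $t_i=-1$ where $a_i=R$, and $t_i=N$ where $a_i=NR$), and for these $$\lim_{N\to\infty}M(\alpha,\gamma_*)=C(R).$$ Consequently the bound $\rho(\alpha)\le C(R)$, for the $\alpha$ with $\liminf_{i\to\infty}a_i=R$, is best possible: if a real $c$ satisfies $\rho(\alpha)\le c$ for all irrational $\alpha\in(0,1)$ with $\liminf_{i\to\infty}a_i=R$, then $c\ge C(R)$. -/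

import Mathlib

open Filter Topology

noncomputable section

/-- The inhomogeneous approximation constant: the lower limit of `|n| * ‖n α - γ‖` over the
integers `n` with `|n| → ∞`, where `‖x‖ = |x - round x|` is the distance to the nearest integer.
It is taken in the extended reals, so that it is always a genuine lower limit. -/
def inhomConst (α γ : ℝ) : EReal :=
  liminf (fun n : ℤ =>
    ((|(n : ℝ)| * |((n : ℝ) * α - γ) - (round ((n : ℝ) * α - γ) : ℝ)| : ℝ) : EReal)) cofinite

/-- `γ` belongs to `ℤ + ℤ α`. -/
def InIntSpan (α γ : ℝ) : Prop := ∃ m n : ℤ, γ = (m : ℝ) + (n : ℝ) * α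

/-- The case of worst inhomogeneous approximation: the supremum of the constants of `α` and `γ`
over the `γ` outside `ℤ + ℤ α`. -/
def worstConst (α : ℝ) : EReal := ⨆ (γ : ℝ) (_ : ¬ InIntSpan α γ), inhomConst α γ

/-- The complete quotients `α₀, α₁, …` of the negative (round-up) expansion. -/
def negTail (α : ℝ) : ℕ → ℝ
  | 0 => Int.fract α
  | n + 1 => (⌈1 / negTail α n⌉ : ℝ) - 1 / negTail α n

/-- The partial quotients of the negative expansion, indexed from `0`:
`negDigit α i` is the partial quotient usually called `a_{i+1}`. -/
def negDigit (α : ℝ) (i : ℕ) : ℤ := ⌈1 / negTail α i⌉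

/-- The product `D_i = α₀ α₁ ⋯ α_i`. -/
def negProd (α : ℝ) (i : ℕ) : ℝ := ∏ j ∈ Finset.range (i + 1), negTail α j

/-- `α = [0; a 0, a 1, a 2, …]⁻`: `α` is an irrational number in `(0, 1)` whose negative expansion
has the partial quotients `a`. -/
structure HasNegExpansion (α : ℝ) (a : ℕ → ℤ) : Prop where
  irrational : Irrational α
  mem : α ∈ Set.Ioo (0 : ℝ) 1
  digit : ∀ i, negDigit α i = a i

/-- `t` is the sequence of digits of the `α`-expansion of `γ`
(indexed from `0`, like the partial quotients). -/
structure IsAlphaExpansion (α γ : ℝ) (t : ℕ → ℤ) : Prop where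
  lower : ∀ i, -(negDigit α i - 2) ≤ t i
  upper : ∀ i, t i ≤ negDigit α i
  parity : ∀ i, t i ≡ negDigit α i [ZMOD 2]
  no_tail : ∀ i, ¬ (t i = negDigit α i ∧ ∀ j, i < j → t j = negDigit α j - 2)
  no_block : ∀ i l, 0 < l → ¬ (t i = negDigit α i ∧ t (i + l) = negDigit α (i + l) ∧
    ∀ j, i < j → j < i + l → t j = negDigit α j - 2)
  hasSum : HasSum (fun i => 1 / 2 * ((negDigit α i : ℝ) - 2 + (t i : ℝ)) * negProd α i) γ

/-- The sequence `x, y, x, y, …`. -/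
def altSeq (x y : ℤ) (i : ℕ) : ℤ := if Even i then x else y

/-- `α = [0; R, N R, R, N R, …]⁻`, and the `α`-expansion of `γ` has the digits
`-1, N, -1, N, …`. -/
structure IsSharpPair (R N : ℕ) (α γ : ℝ) : Prop where
  expansion : HasNegExpansion α (altSeq R (N * R))
  digits : IsAlphaExpansion α γ (altSeq (-1) N)

/-- `C(R) = (1/4) (1 - 1/R) (1 - 1/R²)`. -/
def oddBound (R : ℕ) : ℝ := 1 / 4 * (1 - 1 / (R : ℝ)) * (1 - 1 / (R : ℝ) ^ 2)

end

/-!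
The number `α = [0; R, NR, R, NR, …]⁻` is the root in `(0, 1)` of `x² - NRx + N`, and summing two
geometric series gives `γ = (1 - α)/2 · (1 - N/s)`, where `s = NR - 2α` is the difference between
the conjugate `α' = NR - α` and `α` (`HasNegExpansion.negTail_alt`, `IsSharpPair.gamma_eq`).
So `ξ = nα - m - γ` lies in a coset of `ℤ + ℤα` in the field `ℚ(α)`. With `k = 2n + 1` and
`q = 2m + 1`, its norm is a quarter of the integral quadratic polynomial
`H(k, q) = Nk² + Nk - NRkq - Nq + q²` plus a constant (`cosetElt_mul_conj`). The conjugate `ξ'` is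
`ns + O(1)` for bounded `ξ`, so `|n| ‖nα - γ‖` is asymptotically the norm divided by `s`, and the
approximation constant is `1/s` times the least absolute norm over odd `k` and `q`.

That minimum is found by Vieta jumping. Exchanging the two roots of `H` in either variable keeps `k`
and `q` odd, and this descent leads to pairs for which neither exchange decreases the size of the
variable. On those pairs `H` is large and positive if `k` and `q` have opposite signs, and is at
most `H(1, 1) = -(N(R - 1) - 1)` or `H(-1, -1)`, which is the same number, if the signs agree
(`quadForm_gap`). The minimum is attained infinitely often: alternating the two exchanges from
`(1, 1)` multiplies `ξ` by the unit `Rα - 1 ∈ (0, 1)`, hence `ξ → 0` along this orbit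
(`cosetElt_orbit`). This gives the constant exactly for each `N` (`IsSharpPair.inhomConst_eq`), and
it tends to `C(R)`. Since the norm never vanishes, `γ` is not in `ℤ + ℤα`, and since the partial
quotients of `α` have lower limit `R`, no smaller bound than `C(R)` is possible.
-/

/-! ### A quadratic polynomial on pairs of odd integers -/

/-- Four times the norm of the coset element `cosetElt R N x k q`, up to an additive constant; as
a polynomial in `k` or in `q` alone it is quadratic, with integral sum of roots. -/
def quadForm (R N k q : ℤ) : ℤ := N * k ^ 2 + N * k - N * R * k * q - N * q + q ^ 2

lemma quadForm_reflect_left (R N k q : ℤ) :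
    quadForm R N (R * q - 1 - k) q = quadForm R N k q := by
  unfold quadForm; ring

lemma quadForm_reflect_right (R N k q : ℤ) :
    quadForm R N k (N * (k * R + 1) - q) = quadForm R N k q := by
  unfold quadForm; ring

/-- The bound at the end of the descent. If `k` and `q` have the same sign, then the conditions say
that the gradient points towards `±(1, 1)`, the sign being that of `k`, so the value is at most the
one there. -/
lemma quadForm_reduced {R N k q : ℤ} (hR : 3 ≤ R) (hN : 1 ≤ N) (hk : k ≠ 0) (hq : q ≠ 0)
    (h1 : |k| ≤ |R * q - 1 - k|) (h2 : |q| ≤ |N * (k * R + 1) - q|) :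
    quadForm R N k q ≤ -(N * (R - 1) - 1) ∨ N * (R - 1) ≤ quadForm R N k q := by
  unfold quadForm
  rcases lt_or_gt_of_ne hk with hk | hk <;> rcases lt_or_gt_of_ne hq with hq | hq
  -- In the cases of equal signs `m1` and `m2` are the contributions of the two partial derivatives
  -- at `(k, q)`, and `m3` and `m4` those at `±(1, 1)`: a quadratic polynomial changes along a
  -- segment by the mean of the derivatives at its ends.
  · left
    have e1 : R * q - 1 ≤ 2 * k := by
      rw [abs_of_neg hk] at h1
      rcases le_abs'.mp h1 with h | h
      · nlinarith
      · nlinarith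
    have e2 : N * (k * R + 1) ≤ 2 * q := by
      rw [abs_of_neg hq] at h2
      have : N * (k * R + 1) < 0 := mul_neg_of_pos_of_neg (by omega) (by nlinarith)
      rcases le_abs'.mp h2 with h | h <;> linarith
    have m1 := mul_nonneg (mul_nonneg (by omega : 0 ≤ N) (by omega : 0 ≤ -1 - k))
      (by linarith : 0 ≤ 2 * k - (R * q - 1))
    have m2 := mul_nonneg (by omega : 0 ≤ -1 - q) (by linarith : 0 ≤ 2 * q - N * (k * R + 1))
    have m3 := mul_nonneg (mul_nonneg (by omega : 0 ≤ N) (by omega : 0 ≤ -1 - k))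
      (by linarith : 0 ≤ R - 1)
    have m4 := mul_nonneg (by omega : 0 ≤ -1 - q) (by nlinarith : 0 ≤ N * (R - 1) - 2)
    nlinarith
  · right
    have := mul_nonneg (by omega : 0 ≤ N) (mul_nonneg (by omega : 0 ≤ -1 - k) (by omega : 0 ≤ -k))
    have := mul_nonneg (mul_nonneg (by omega : 0 ≤ N) (by omega : 0 ≤ q - 1))
      (by nlinarith : 0 ≤ -k * R - 1)
    have := mul_nonneg (mul_nonneg (by omega : 0 ≤ N) (by omega : 0 ≤ -1 - k)) (by omega : 0 ≤ R)
    nlinarith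
  · right
    have := mul_nonneg (mul_nonneg (by omega : 0 ≤ N) (by omega : 0 ≤ -1 - q))
      (by nlinarith : 0 ≤ k * R + 1)
    have := mul_nonneg (mul_nonneg (by omega : 0 ≤ N) (by omega : 0 ≤ k - 1)) (by omega : 0 ≤ R)
    nlinarith
  · left
    have e1 : 2 * k ≤ R * q - 1 := by
      rw [abs_of_pos hk] at h1
      have : 0 < R * q - 1 := by nlinarith
      rcases le_abs'.mp h1 with h | h <;> linarith
    have e2 : 2 * q ≤ N * (k * R + 1) := by
      rw [abs_of_pos hq] at h2
      have : 0 < N * (k * R + 1) := mul_pos (by omega) (by nlinarith)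
      rcases le_abs'.mp h2 with h | h <;> linarith
    have m1 := mul_nonneg (mul_nonneg (by omega : 0 ≤ N) (by omega : 0 ≤ k - 1))
      (by linarith : 0 ≤ (R * q - 1) - 2 * k)
    have m2 := mul_nonneg (by omega : 0 ≤ q - 1) (by linarith : 0 ≤ N * (k * R + 1) - 2 * q)
    have m3 := mul_nonneg (mul_nonneg (by omega : 0 ≤ N) (by omega : 0 ≤ k - 1))
      (by linarith : 0 ≤ R - 3)
    have m4 := mul_nonneg (by omega : 0 ≤ q - 1) (by nlinarith : 0 ≤ N * (R + 1) - 2)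
    nlinarith

/-- Vieta jumping: both reflections preserve oddness, and one of them decreases `|k| + |q|` unless
`quadForm_reduced` applies. -/
lemma quadForm_gap {R N : ℤ} (hodd : Odd R) (hR : 3 ≤ R) (hN : 1 ≤ N) {k q : ℤ}
    (hk : Odd k) (hq : Odd q) :
    quadForm R N k q ≤ -(N * (R - 1) - 1) ∨ N * (R - 1) ≤ quadForm R N k q := by
  induction hn : k.natAbs + q.natAbs using Nat.strong_induction_on generalizing k q with
  | _ n ih =>
    by_cases h1 : |k| ≤ |R * q - 1 - k|
    · by_cases h2 : |q| ≤ |N * (k * R + 1) - q|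
      · exact quadForm_reduced hR hN (by rintro rfl; simp at hk) (by rintro rfl; simp at hq) h1 h2
      · rw [← quadForm_reflect_right]
        exact ih _ (by zify at hn ⊢; linarith) hk
          (((hk.mul hodd).add_odd odd_one).mul_left N |>.sub_odd hq) rfl
    · rw [← quadForm_reflect_left]
      exact ih _ (by zify at hn ⊢; linarith) (((hodd.mul hq).sub_odd odd_one).sub_odd hk) hq rfl

/-! ### Negative continued fractions with alternating partial quotients -/

/-- The partial quotients determine the complete quotients: as these are at most `1/2`, the map
`t ↦ 1 / (a - t)` contracts distances between them by a factor of at least `4`. -/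
lemma negExpansion_unique {a : ℕ → ℝ} {u v : ℕ → ℝ} (ha : ∀ i, 3 ≤ a i)
    (hu : ∀ i, u i ∈ Set.Ioo (0 : ℝ) 1) (hv : ∀ i, v i ∈ Set.Ioo (0 : ℝ) 1)
    (hu' : ∀ i, u i * (a i - u (i + 1)) = 1) (hv' : ∀ i, v i * (a i - v (i + 1)) = 1) :
    u = v := by
  have half : ∀ w : ℕ → ℝ, (∀ i, w i ∈ Set.Ioo (0 : ℝ) 1) → (∀ i, w i * (a i - w (i + 1)) = 1) →
      ∀ i, w i ≤ 1 / 2 := fun w hw hw' i => by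
    nlinarith [(hw i).1, (hw (i + 1)).2, ha i, hw' i,
      mul_nonneg (hw i).1.le (by linarith [(hw (i + 1)).2, ha i] : 0 ≤ a i - w (i + 1) - 2)]
  have step : ∀ i, |u i - v i| ≤ 1 / 4 * |u (i + 1) - v (i + 1)| := fun i => by
    have : u i - v i = u i * v i * (u (i + 1) - v (i + 1)) := by
      linear_combination -u i * hv' i + v i * hu' i
    rw [this, abs_mul, abs_of_pos (mul_pos (hu i).1 (hv i).1)]
    gcongr
    nlinarith [half u hu hu' i, half v hv hv' i, (hu i).1, (hv i).1]
  have iter : ∀ j i, |u i - v i| ≤ (1 / 4) ^ j * |u (i + j) - v (i + j)| := fun j => by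
    induction j with
    | zero => simp
    | succ j ih =>
      intro i
      refine (step i).trans ?_
      have := ih (i + 1)
      rw [show i + 1 + j = i + (j + 1) by ring] at this
      rw [pow_succ]
      linarith
  funext i
  have lim : Tendsto (fun j : ℕ => ((1 : ℝ) / 4) ^ j) atTop (𝓝 0) :=
    tendsto_pow_atTop_nhds_zero_of_lt_one (by norm_num) (by norm_num)
  have : |u i - v i| ≤ 0 := ge_of_tendsto' lim fun j => (iter j i).trans <|
    mul_le_of_le_one_right (by positivity) (abs_le.mpr
      ⟨by linarith [(hu (i + j)).1, (hv (i + j)).2], by linarith [(hu (i + j)).2, (hv (i + j)).1]⟩)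
  exact sub_eq_zero.mp (abs_nonpos_iff.mp this)

lemma negTail_mem {α : ℝ} (h : Irrational α) (i : ℕ) :
    Irrational (negTail α i) ∧ negTail α i ∈ Set.Ioo (0 : ℝ) 1 := by
  have pos : ∀ x : ℝ, Irrational x → 0 ≤ x → 0 < x := fun x hx h0 =>
    h0.lt_of_ne' hx.ne_zero
  induction i with
  | zero =>
    have : Irrational (Int.fract α) := h.sub_intCast _
    exact ⟨this, pos _ this (Int.fract_nonneg _), Int.fract_lt_one _⟩
  | succ i ih =>
    have hi : Irrational (negTail α (i + 1)) := by
      rw [negTail, one_div]; exact (irrational_inv_iff.mpr ih.1).intCast_sub _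
    refine ⟨hi, pos _ hi ?_, ?_⟩ <;> rw [negTail]
    · linarith [Int.le_ceil (1 / negTail α i)]
    · linarith [Int.ceil_lt_add_one (1 / negTail α i)]

lemma negTail_mul {α : ℝ} (h : Irrational α) (i : ℕ) :
    negTail α i * (negDigit α i - negTail α (i + 1)) = 1 := by
  have := (negTail_mem h i).2.1.ne'
  rw [negTail, negDigit]
  field_simp
  ring

lemma altSeq_even (x y : ℤ) (i : ℕ) : altSeq x y (2 * i) = x := by simp [altSeq]

lemma altSeq_odd (x y : ℤ) (i : ℕ) : altSeq x y (2 * i + 1) = y := by simp [altSeq]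

lemma altSeq_add_two (x y : ℤ) (i : ℕ) : altSeq x y (i + 2) = altSeq x y i := by
  simp [altSeq, Nat.even_add]

lemma three_le_altSeq {R N : ℕ} (hR : 3 ≤ R) (hN : 1 ≤ N) (i : ℕ) :
    3 ≤ altSeq R (N * R) i := by
  unfold altSeq; split_ifs
  · exact_mod_cast hR
  · exact_mod_cast hR.trans (Nat.le_mul_of_pos_left R hN)

/-- The complete quotients have period two, because their shift by two has the same partial
quotients. -/
lemma HasNegExpansion.negTail_alt {R N : ℕ} {α : ℝ} (hR : 3 ≤ R) (hN : 1 ≤ N)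
    (h : HasNegExpansion α (altSeq R (N * R))) :
    α ^ 2 - N * R * α + N = 0 ∧
      ∀ i, negTail α (2 * i) = α ∧ negTail α (2 * i + 1) = α / N := by
  have hN0 : (N : ℝ) ≠ 0 := by positivity
  have h0 : negTail α 0 = α := Int.fract_eq_self.mpr ⟨h.mem.1.le, h.mem.2⟩
  have hrec : ∀ i, negTail α i * ((altSeq R (N * R) i : ℤ) - negTail α (i + 1)) = 1 := fun i => by
    rw [← h.digit i]; exact negTail_mul h.irrational i
  have per : (fun i => negTail α (i + 2)) = negTail α :=
    negExpansion_unique (a := fun i => ((altSeq R (N * R) i : ℤ) : ℝ))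
      (fun i => by exact_mod_cast three_le_altSeq hR hN i)
      (fun i => (negTail_mem h.irrational _).2) (fun i => (negTail_mem h.irrational _).2)
      (fun i => by have := hrec (i + 2); rwa [altSeq_add_two] at this) hrec
  have r0 := hrec 0
  have r1 := hrec 1
  have r2 : negTail α 2 = α := (congrFun per 0).trans h0
  simp only [altSeq, h0, zero_add, Nat.not_even_one, Even.zero, if_true, if_false, Nat.reduceAdd, r2] at r0 r1
  push_cast at r0 r1
  have h1 : negTail α 1 = α / N := by
    have hRpos : (R : ℝ) ≠ 0 := by positivity
    rw [eq_div_iff hN0]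
    apply mul_left_cancel₀ hRpos
    linear_combination r1 - r0
  refine ⟨?_, fun i => ?_⟩
  · rw [h1] at r0; field_simp at r0; linear_combination -r0
  · induction i with
    | zero => exact ⟨h0, h1⟩
    | succ i ih =>
      exact ⟨(congrFun per (2 * i)).trans ih.1, (congrFun per (2 * i + 1)).trans ih.2⟩

lemma denom_pos {R N : ℕ} {x : ℝ} (hR : 3 ≤ R) (hN : 1 ≤ N) (hx : x ∈ Set.Ioo (0 : ℝ) 1) :
    0 < (N : ℝ) * R - 2 * x := by
  have h1 : (3 : ℝ) ≤ R := by exact_mod_cast hR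
  have h2 : (1 : ℝ) ≤ N := by exact_mod_cast hN
  nlinarith [hx.2]

/-! ### The number with the alternating digits -/

lemma hasSum_alt {R N : ℕ} {α : ℝ} (hR : 3 ≤ R) (hN : 1 ≤ N)
    (h : HasNegExpansion α (altSeq R (N * R))) :
    HasSum (fun i => 1 / 2 * ((negDigit α i : ℝ) - 2 + (altSeq (-1) N i : ℝ)) * negProd α i)
      ((1 - α) / 2 * (1 - N / (N * R - 2 * α))) := by
  obtain ⟨hquad, htail⟩ := h.negTail_alt hR hN
  obtain ⟨hα0, hα1⟩ := h.mem
  have hN1 : (1 : ℝ) ≤ N := by exact_mod_cast hN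
  have hN0 : (N : ℝ) ≠ 0 := by positivity
  have hs := denom_pos hR hN h.mem
  -- `δ` is the product of two consecutive complete quotients, the ratio of both geometric series.
  set δ : ℝ := α * (α / N) with hδ
  have hδ0 : 0 ≤ δ := by positivity
  have hδ1 : δ < 1 := by
    rw [hδ, ← mul_div_assoc, div_lt_one (by positivity)]
    nlinarith
  have hδR : δ = R * α - 1 := by rw [hδ]; field_simp; linear_combination hquad
  have hprod : ∀ i, negProd α (2 * i) = α * δ ^ i ∧ negProd α (2 * i + 1) = δ ^ (i + 1) := by
    intro i
    have key : ∏ j ∈ Finset.range (2 * i), negTail α j = δ ^ i := by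
      induction i with
      | zero => simp
      | succ i ih =>
        rw [show 2 * (i + 1) = 2 * i + 1 + 1 by ring, Finset.prod_range_succ,
          Finset.prod_range_succ, ih, (htail i).1, (htail i).2, hδ]
        ring
    have e1 : negProd α (2 * i) = α * δ ^ i := by
      rw [negProd, Finset.prod_range_succ, key, (htail i).1, mul_comm]
    refine ⟨e1, ?_⟩
    rw [negProd, Finset.prod_range_succ, ← negProd, e1, (htail i).2, hδ]
    ring
  have geom := hasSum_geometric_of_lt_one hδ0 hδ1
  have he := geom.mul_left (((R : ℝ) - 3) / 2 * α)
  have ho := geom.mul_left (((N : ℝ) * R + N - 2) / 2 * δ)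
  have hval : ((R : ℝ) - 3) / 2 * α * (1 - δ)⁻¹ + ((N : ℝ) * R + N - 2) / 2 * δ * (1 - δ)⁻¹ =
      (1 - α) / 2 * (1 - N / (N * R - 2 * α)) := by
    have hd : (1 - δ) * N = α * (N * R - 2 * α) := by
      rw [hδR]; linear_combination 2 * hquad
    have hd' : (1 - δ)⁻¹ = N / (α * (N * R - 2 * α)) := by
      rw [← hd]; field_simp [(sub_pos.mpr hδ1).ne']
    have hnum : (((R : ℝ) - 3) / 2 * α + (N * R + N - 2) / 2 * (R * α - 1)) * N =
        (1 - α) / 2 * (N * R - 2 * α - N) * α := by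
      linear_combination -((N * R + N - 2) + 2 * α) / 2 * hquad
    rw [hd', hδR, ← add_mul, mul_div_assoc', hnum, one_sub_div hs.ne']
    field_simp
  rw [← hval]
  refine HasSum.even_add_odd ?_ ?_
  · refine Eq.subst (motive := fun f => HasSum f _) (funext fun i => Eq.symm ?_) he
    rw [h.digit, altSeq_even, altSeq_even, (hprod i).1]
    push_cast; ring
  · refine Eq.subst (motive := fun f => HasSum f _) (funext fun i => Eq.symm ?_) ho
    rw [h.digit, altSeq_odd, altSeq_odd, (hprod i).2]
    push_cast; ring

lemma IsSharpPair.gamma_eq {R N : ℕ} {α γ : ℝ} (hR : 3 ≤ R) (hN : 1 ≤ N)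
    (h : IsSharpPair R N α γ) : γ = (1 - α) / 2 * (1 - N / (N * R - 2 * α)) :=
  h.digits.hasSum.unique (hasSum_alt hR hN h.expansion)

/-! ### Existence of the numbers -/

lemma gamma_mem {R N : ℕ} {x : ℝ} (hR : 3 ≤ R) (hN : 1 ≤ N) (hx : x ∈ Set.Ioo (0 : ℝ) 1)
    (hquad : x ^ 2 - N * R * x + N = 0) :
    (1 - x) / 2 * (1 - N / (N * R - 2 * x)) ∈ Set.Ioo (0 : ℝ) 1 := by
  have hs := denom_pos hR hN hx
  have h1 : (3 : ℝ) ≤ R := by exact_mod_cast hR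
  have h2 : (1 : ℝ) ≤ N := by exact_mod_cast hN
  have hlt : (N : ℝ) / (N * R - 2 * x) < 1 := by
    rw [div_lt_one hs]; nlinarith [hx.2]
  have hpos : 0 < (N : ℝ) / (N * R - 2 * x) := by positivity
  constructor <;> nlinarith [hx.1, hx.2, mul_pos hx.1 hpos]

/-- The number is `(NR - √(N²R² - 4N)) / 2`; the discriminant is not a square, as it lies strictly
between `(NR - 1)²` and `(NR)²`. -/
lemma exists_hasNegExpansion {R N : ℕ} (hR : 3 ≤ R) (hN : 1 ≤ N) :
    ∃ α : ℝ, HasNegExpansion α (altSeq R (N * R)) := by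
  have h1 : (3 : ℝ) ≤ R := by exact_mod_cast hR
  have h2 : (1 : ℝ) ≤ N := by exact_mod_cast hN
  have hle : 4 * N ≤ (N * R) ^ 2 := by
    calc 4 * N ≤ N * 9 := by omega
      _ ≤ N * (N * R ^ 2) := by gcongr; nlinarith
      _ = _ := by ring
  set m : ℕ := (N * R) ^ 2 - 4 * N with hm
  have hmR : (m : ℝ) = (N * R) ^ 2 - 4 * N := by rw [hm, Nat.cast_sub hle]; push_cast; ring
  have hNR : (3 : ℝ) * N ≤ N * R := by nlinarith
  have lo : (N * R - 1 : ℝ) < √m := by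
    apply Real.lt_sqrt_of_sq_lt
    rw [hmR]; nlinarith
  have hi : √m < (N * R : ℝ) := by
    rw [Real.sqrt_lt' (by positivity), hmR]; linarith
  have hsq : √(m : ℝ) ^ 2 = (N * R) ^ 2 - 4 * N := by rw [Real.sq_sqrt (by positivity), hmR]
  have hirr : Irrational √(m : ℝ) := by
    rw [irrational_sqrt_natCast_iff]
    rintro ⟨r, hr⟩
    rw [hr, Nat.cast_mul, Real.sqrt_mul_self (by positivity)] at lo hi
    have lo' : N * R < r + 1 := by exact_mod_cast (by linarith : (N * R : ℝ) < r + 1)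
    have hi' : r < N * R := by exact_mod_cast hi
    omega
  set α : ℝ := (N * R - √m) / 2 with hα
  have hα0 : 0 < α := by rw [hα]; linarith
  have hα1 : α < 1 := by rw [hα]; linarith
  have hquad : α ^ 2 - N * R * α + N = 0 := by rw [hα]; linear_combination hsq / 4
  have hαirr : Irrational α := by
    have := (hirr.natCast_sub (N * R)).div_natCast (m := 2) (by norm_num)
    simpa [hα] using this
  have hαN : α / N < 1 := by rw [div_lt_one (by positivity)]; linarith
  have hαN0 : 0 < α / N := by positivity
  have inv0 : 1 / α = R - α / N := by field_simp; linear_combination hquad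
  have inv1 : 1 / (α / N) = N * R - α := by field_simp; linear_combination hquad
  have ceil0 : ⌈1 / α⌉ = (R : ℤ) := by
    rw [inv0, Int.ceil_eq_iff]; push_cast; constructor <;> linarith
  have ceil1 : ⌈1 / (α / N)⌉ = (N * R : ℤ) := by
    rw [inv1, Int.ceil_eq_iff]; push_cast; constructor <;> linarith
  have tail : ∀ i, negTail α (2 * i) = α ∧ negTail α (2 * i + 1) = α / N := fun i => by
    have odd : ∀ i, negTail α (2 * i) = α → negTail α (2 * i + 1) = α / N := fun i hi => by
      rw [negTail, hi, ceil0, inv0]; push_cast; ring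
    induction i with
    | zero =>
      have h0 : negTail α (2 * 0) = α := Int.fract_eq_self.mpr ⟨hα0.le, hα1⟩
      exact ⟨h0, odd 0 h0⟩
    | succ i ih =>
      have he : negTail α (2 * (i + 1)) = α := by
        rw [show 2 * (i + 1) = (2 * i + 1) + 1 by ring, negTail, ih.2, ceil1, inv1]
        push_cast; ring
      exact ⟨he, odd _ he⟩
  refine ⟨α, hαirr, ⟨hα0, hα1⟩, fun i => ?_⟩
  rcases Nat.even_or_odd' i with ⟨j, rfl | rfl⟩
  · rw [negDigit, (tail j).1, ceil0, altSeq_even]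
  · rw [negDigit, (tail j).2, ceil1, altSeq_odd]

lemma exists_isSharpPair {R N : ℕ} (hodd : Odd R) (hR : 3 ≤ R) (hN : 1 ≤ N) :
    ∃ α γ : ℝ, IsSharpPair R N α γ := by
  obtain ⟨α, h⟩ := exists_hasNegExpansion hR hN
  have hNR : N < N * R := lt_mul_of_one_lt_right hN (by omega)
  have hne : ∀ i, altSeq (-1) N i ≠ altSeq R (N * R) i := fun i => by
    unfold altSeq; split_ifs
    · omega
    · exact_mod_cast hNR.ne
  refine ⟨α, _, h, ⟨fun i => ?_, fun i => ?_, fun i => ?_, fun i hi => ?_, fun i l _ hi => ?_,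
    hasSum_alt hR hN h⟩⟩
  · rw [h.digit]; unfold altSeq; split_ifs
    · omega
    · have : (3 : ℤ) ≤ N * R := by exact_mod_cast hR.trans (Nat.le_mul_of_pos_left R hN)
      omega
  · rw [h.digit]; unfold altSeq; split_ifs
    · omega
    · exact_mod_cast hNR.le
  · rw [h.digit]; obtain ⟨r, rfl⟩ := hodd
    unfold altSeq; split_ifs <;> rw [Int.modEq_iff_dvd]
    · exact ⟨r + 1, by push_cast; ring⟩
    · exact ⟨N * r, by push_cast; ring⟩
  · exact hne i (hi.1.trans (h.digit i))
  · exact hne i (hi.1.trans (h.digit i))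

/-! ### The coset of `γ` and its norm form -/

/-- The constant term of the norm form on the coset of `γ`, normalised so that four times the norm
is `quadForm R N k q + N * quadConst R N`. -/
noncomputable def quadConst (R N : ℝ) : ℝ := (N * R - N - 1) / (N * R ^ 2 - 4)

/-- The least absolute value of the norm on the coset of `γ`. -/
noncomputable def minNorm (R N : ℝ) : ℝ := (N * (R - 1) - 1 - N * quadConst R N) / 4

/-- The element `n x - m - γ` of the coset, with `k = 2 n + 1` and `q = 2 m + 1` (see
`cosetElt_eq`). It is a rational function of `x`, so that the conjugate element is obtained by
putting the conjugate root `N R - x` for `x`. -/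
noncomputable def cosetElt (R N : ℕ) (x : ℝ) (k q : ℤ) : ℝ :=
  (k * x - q) / 2 + N * (1 - x) / (2 * (N * R - 2 * x))

lemma cosetElt_mul_conj {R N : ℕ} {x : ℝ} (hs : (N : ℝ) * R - 2 * x ≠ 0) (hN : (N : ℝ) ≠ 0)
    (hd : (N : ℝ) * R ^ 2 - 4 ≠ 0)
    (hquad : x ^ 2 - N * R * x + N = 0) (k q : ℤ) :
    cosetElt R N x k q * cosetElt R N (N * R - x) k q =
      ((quadForm R N k q : ℤ) + N * quadConst R N) / 4 := by
  have hs2 : (N * R - 2 * x) ^ 2 = N * (N * R ^ 2 - 4) := by linear_combination 4 * hquad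
  have hc : (N : ℝ) * quadConst R N = N ^ 2 * (N * R - N - 1) / (N * R - 2 * x) ^ 2 := by
    rw [hs2, quadConst]; field_simp
  have hconj : cosetElt R N (N * R - x) k q =
      (k * (N * R - x) - q) / 2 - N * (1 - (N * R - x)) / (2 * (N * R - 2 * x)) := by
    rw [cosetElt, show (N : ℝ) * R - 2 * (N * R - x) = -(N * R - 2 * x) by ring]
    field_simp; ring
  rw [hc, hconj, cosetElt, quadForm]
  have hx : x * (N * R - x) = N := by linear_combination -hquad
  generalize hz : (N : ℝ) * R - x = z at *
  have hs' : (N : ℝ) * R - 2 * x = z - x := by rw [← hz]; ring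
  rw [hs'] at hs ⊢
  push_cast
  rw [show (N : ℝ) * R * k * q = (x + z) * k * q by rw [← hz]; ring,
    show (N : ℝ) * R - N - 1 = (x + z) - N - 1 by rw [← hz]; ring, ← hx]
  field_simp
  ring

/-- Both reflections of `quadForm` in succession multiply the element of the coset by the unit
`R x - 1`. -/
lemma cosetElt_step {R N : ℕ} {x : ℝ} (hs : (N : ℝ) * R - 2 * x ≠ 0)
    (hquad : x ^ 2 - N * R * x + N = 0) (k q : ℤ) :
    cosetElt R N x (R * (N * (k * R + 1) - q) - 1 - k) (N * (k * R + 1) - q) =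
      (R * x - 1) * cosetElt R N x k q := by
  have he : N * (1 - x) / (2 * (N * R - 2 * x)) * (R * x - 2) = ((R * N - 1) * x - N) / 2 := by
    rw [div_mul_eq_mul_div, div_eq_div_iff (mul_ne_zero two_ne_zero hs) two_ne_zero]
    linear_combination 2 * (N * R - 2) * hquad
  unfold cosetElt
  push_cast
  linear_combination -(k * R / 2 : ℝ) * hquad - he

lemma cosetElt_eq (R N : ℕ) (x : ℝ) (n m : ℤ) :
    cosetElt R N x (2 * n + 1) (2 * m + 1) =
      n * x - (1 - x) / 2 * (1 - N / (N * R - 2 * x)) - m := by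
  unfold cosetElt
  push_cast
  rw [mul_comm 2 ((N : ℝ) * R - 2 * x), ← div_div]
  ring

lemma quadConst_bounds {R N : ℝ} (hR : 3 ≤ R) (hN : 1 ≤ N) :
    0 ≤ quadConst R N ∧ quadConst R N ≤ 1 / 2 := by
  have hd : 0 < N * R ^ 2 - 4 := by nlinarith [mul_nonneg (by linarith : 0 ≤ N - 1) (sq_nonneg R)]
  unfold quadConst
  constructor
  · apply div_nonneg _ hd.le; nlinarith
  · rw [div_le_iff₀ hd]; nlinarith [mul_nonneg (by linarith : 0 ≤ N - 1) (sq_nonneg (R - 1))]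

lemma minNorm_pos {R N : ℝ} (hR : 3 ≤ R) (hN : 1 ≤ N) : 0 < minNorm R N := by
  unfold minNorm
  nlinarith [(quadConst_bounds hR hN).2]

lemma minNorm_le {R N : ℕ} {x : ℝ} (hodd : Odd R) (hR : 3 ≤ R) (hN : 1 ≤ N)
    (hx : x ∈ Set.Ioo (0 : ℝ) 1) (hquad : x ^ 2 - N * R * x + N = 0) {k q : ℤ}
    (hk : Odd k) (hq : Odd q) :
    minNorm R N ≤ |cosetElt R N x k q * cosetElt R N (N * R - x) k q| := by
  have h1 : (3 : ℝ) ≤ R := by exact_mod_cast hR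
  have h2 : (1 : ℝ) ≤ N := by exact_mod_cast hN
  have hc := quadConst_bounds h1 h2
  rw [cosetElt_mul_conj (by nlinarith [hx.2]) (by positivity)
    (by nlinarith [mul_nonneg (by linarith : 0 ≤ (N : ℝ) - 1) (sq_nonneg (R : ℝ))]) hquad, minNorm]
  rcases quadForm_gap (R := R) (N := N) (by exact_mod_cast hodd) (by exact_mod_cast hR)
    (by exact_mod_cast hN) hk hq with h | h
  · have h' : ((quadForm R N k q : ℤ) : ℝ) ≤ -(N * (R - 1) - 1) := by exact_mod_cast h
    rw [le_abs]; right; linarith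
  · have h' : (N : ℝ) * (R - 1) ≤ (quadForm R N k q : ℤ) := by exact_mod_cast h
    rw [le_abs]; left; nlinarith

/-! ### Infinitely many elements of minimal norm -/

/-- The pairs obtained from `(1, 1)` by alternating the reflections of `quadForm`. -/
def minOrbit (R N : ℤ) : ℕ → ℤ × ℤ
  | 0 => (1, 1)
  | j + 1 =>
    let q := N * ((minOrbit R N j).1 * R + 1) - (minOrbit R N j).2
    (R * q - 1 - (minOrbit R N j).1, q)

lemma orbit_odd {R : ℤ} (hodd : Odd R) (N : ℤ) (j : ℕ) :
    Odd (minOrbit R N j).1 ∧ Odd (minOrbit R N j).2 := by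
  induction j with
  | zero => exact ⟨odd_one, odd_one⟩
  | succ j ih =>
    have hq : Odd (N * ((minOrbit R N j).1 * R + 1) - (minOrbit R N j).2) :=
      ((ih.1.mul hodd).add_odd odd_one).mul_left N |>.sub_odd ih.2
    exact ⟨((hodd.mul hq).sub_odd odd_one).sub_odd ih.1, hq⟩

lemma quadForm_orbit (R N : ℤ) (j : ℕ) :
    quadForm R N (minOrbit R N j).1 (minOrbit R N j).2 = -(N * (R - 1) - 1) := by
  induction j with
  | zero => simp only [minOrbit, quadForm]; ring
  | succ j ih => rw [minOrbit, quadForm_reflect_left, quadForm_reflect_right, ih]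

lemma cosetElt_orbit {R N : ℕ} {x : ℝ} (hs : (N : ℝ) * R - 2 * x ≠ 0)
    (hquad : x ^ 2 - N * R * x + N = 0) (j : ℕ) :
    cosetElt R N x (minOrbit R N j).1 (minOrbit R N j).2 =
      cosetElt R N x 1 1 * (R * x - 1) ^ j := by
  induction j with
  | zero => simp [minOrbit]
  | succ j ih => rw [minOrbit, cosetElt_step hs hquad, ih]; ring

/-! ### The approximation constant -/

/-- If `m` is the integer nearest to `n x - γ`, then the conjugate of `n x - m - γ` is at most
`|n| s + C`, with a constant `C` and `s = N R - 2 x`, while the product of the two is at least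
`minNorm R N`. -/
lemma le_inhomConst {R N : ℕ} {x : ℝ} (hodd : Odd R) (hR : 3 ≤ R) (hN : 1 ≤ N)
    (hx : x ∈ Set.Ioo (0 : ℝ) 1) (hquad : x ^ 2 - N * R * x + N = 0) :
    ((minNorm R N / (N * R - 2 * x) : ℝ) : EReal) ≤
      inhomConst x ((1 - x) / 2 * (1 - N / (N * R - 2 * x))) := by
  have h1 : (3 : ℝ) ≤ R := by exact_mod_cast hR
  have h2 : (1 : ℝ) ≤ N := by exact_mod_cast hN
  set s : ℝ := N * R - 2 * x with hsdef
  have hs : 0 < s := by rw [hsdef]; nlinarith [hx.2]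
  set γ : ℝ := (1 - x) / 2 * (1 - N / s) with hγ
  set C : ℝ := |cosetElt R N (N * R - x) 1 1 - cosetElt R N x 1 1| + 1 with hC
  have hμ := minNorm_pos h1 h2
  have low : ∀ n : ℤ, minNorm R N * (|(n : ℝ)| / (|(n : ℝ)| * s + C)) ≤
      |(n : ℝ)| * |((n : ℝ) * x - γ) - (round ((n : ℝ) * x - γ) : ℝ)| := by
    intro n
    have hpos : 0 < |(n : ℝ)| * s + C := by positivity
    set m : ℤ := round ((n : ℝ) * x - γ)
    have hξ : (n : ℝ) * x - γ - m = cosetElt R N x (2 * n + 1) (2 * m + 1) :=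
      (cosetElt_eq R N x n m).symm
    have hsmall : |(n : ℝ) * x - γ - m| ≤ 1 / 2 := abs_sub_round _
    have hnorm := minNorm_le hodd hR hN hx hquad (k := 2 * n + 1) (q := 2 * m + 1)
      ⟨n, rfl⟩ ⟨m, rfl⟩
    have hconj : cosetElt R N (N * R - x) (2 * n + 1) (2 * m + 1) =
        cosetElt R N x (2 * n + 1) (2 * m + 1) + n * s +
          (cosetElt R N (N * R - x) 1 1 - cosetElt R N x 1 1) := by
      unfold cosetElt; push_cast; rw [hsdef]; ring
    have hle : |cosetElt R N (N * R - x) (2 * n + 1) (2 * m + 1)| ≤ |(n : ℝ)| * s + C := by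
      rw [hconj, ← hξ]
      refine (abs_add_le _ _).trans ?_
      have := abs_add_le ((n : ℝ) * x - γ - m) (n * s)
      rw [abs_mul, abs_of_pos hs] at this
      rw [hC]; linarith
    rw [hξ, mul_div_assoc', div_le_iff₀ hpos, mul_comm, mul_assoc]
    refine mul_le_mul_of_nonneg_left (hnorm.trans ?_) (abs_nonneg _)
    rw [abs_mul]
    exact mul_le_mul_of_nonneg_left hle (abs_nonneg _)
  have habs : Tendsto (fun n : ℤ => |(n : ℝ)|) cofinite atTop :=
    (tendsto_norm_cocompact_atTop (E := ℝ)).comp Int.tendsto_coe_cofinite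
  have lim : Tendsto (fun n : ℤ => minNorm R N * (|(n : ℝ)| / (|(n : ℝ)| * s + C))) cofinite
      (𝓝 (minNorm R N / s)) := by
    have h3 : Tendsto (fun n : ℤ => minNorm R N / (s + C / |(n : ℝ)|)) cofinite
        (𝓝 (minNorm R N / (s + 0))) :=
      tendsto_const_nhds.div (tendsto_const_nhds.add (tendsto_const_nhds.div_atTop habs))
        (by simpa using hs.ne')
    rw [add_zero] at h3
    refine h3.congr' ?_
    filter_upwards [habs.eventually_gt_atTop 0] with n hn
    field_simp
  have lim' := (continuous_coe_real_ereal.tendsto _).comp lim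
  rw [← lim'.liminf_eq]
  exact liminf_le_liminf (Eventually.of_forall fun n => EReal.coe_le_coe_iff.mpr (low n))

/-- Along the orbit of `(1, 1)` the product of `ξ = n x - m - γ` and its conjugate
`ξ + n s + g` is `-minNorm R N`, and `ξ → 0`; hence `n ξ → -minNorm R N / s`. -/
lemma inhomConst_le {R N : ℕ} {x : ℝ} (hodd : Odd R) (hR : 3 ≤ R) (hN : 1 ≤ N)
    (hx : x ∈ Set.Ioo (0 : ℝ) 1) (hquad : x ^ 2 - N * R * x + N = 0) :
    inhomConst x ((1 - x) / 2 * (1 - N / (N * R - 2 * x))) ≤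
      ((minNorm R N / (N * R - 2 * x) : ℝ) : EReal) := by
  have h1 : (3 : ℝ) ≤ R := by exact_mod_cast hR
  have h2 : (1 : ℝ) ≤ N := by exact_mod_cast hN
  set s : ℝ := N * R - 2 * x with hsdef
  have hs : 0 < s := by rw [hsdef]; nlinarith [hx.2]
  set γ : ℝ := (1 - x) / 2 * (1 - N / s) with hγ
  have hμ := minNorm_pos h1 h2
  have hoddZ : Odd (R : ℤ) := by exact_mod_cast hodd
  choose n hn using fun j => (orbit_odd hoddZ N j).1
  choose m hm using fun j => (orbit_odd hoddZ N j).2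
  set ξ : ℕ → ℝ := fun j => (n j : ℝ) * x - γ - m j with hξdef
  set g : ℝ := cosetElt R N (N * R - x) 1 1 - cosetElt R N x 1 1 with hg
  have hξ : ∀ j, ξ j = cosetElt R N x (2 * n j + 1) (2 * m j + 1) := fun j =>
    (cosetElt_eq R N x (n j) (m j)).symm
  have hξ0 : Tendsto ξ atTop (𝓝 0) := by
    have hδ : N * (R * x - 1) = x ^ 2 := by linear_combination -hquad
    have := (tendsto_pow_atTop_nhds_zero_of_lt_one (r := (R : ℝ) * x - 1)
      (by nlinarith [hx.1]) (by nlinarith [hx.1, hx.2])).const_mul (cosetElt R N x 1 1)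
    rw [mul_zero] at this
    refine this.congr fun j => ?_
    rw [hξ, ← hn, ← hm, cosetElt_orbit hs.ne' hquad]
  have hprod : ∀ j, ξ j * (ξ j + n j * s + g) = -minNorm R N := fun j => by
    have := cosetElt_mul_conj hs.ne' (by positivity)
      (by nlinarith [mul_nonneg (by linarith : 0 ≤ (N : ℝ) - 1) (sq_nonneg (R : ℝ))]) hquad
      (minOrbit R N j).1 (minOrbit R N j).2
    rw [quadForm_orbit, hn, hm] at this
    have hconj : cosetElt R N (N * R - x) (2 * n j + 1) (2 * m j + 1) = ξ j + n j * s + g := by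
      rw [hξ]; unfold g cosetElt; push_cast; rw [hsdef]; ring
    rw [← hconj, hξ, this, minNorm]
    push_cast; ring
  have hnξ : Tendsto (fun j => (n j : ℝ) * ξ j) atTop (𝓝 (-minNorm R N / s)) := by
    have : Tendsto (fun j => (-minNorm R N - ξ j * (ξ j + g)) / s) atTop
        (𝓝 ((-minNorm R N - 0 * (0 + g)) / s)) :=
      (tendsto_const_nhds.sub (hξ0.mul (hξ0.add tendsto_const_nhds))).div_const s
    rw [zero_mul, sub_zero] at this
    refine this.congr fun j => ?_
    rw [div_eq_iff hs.ne']; linear_combination -hprod j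
  have hne : -minNorm R N / s ≠ 0 := div_ne_zero (neg_ne_zero.mpr hμ.ne') hs.ne'
  -- The `n j` leave every finite set, since `n ξ → 0` for a fixed `n` whereas `n j * ξ j` does not.
  have hcof : Tendsto n atTop cofinite := by
    rw [Tendsto, le_cofinite_iff_eventually_ne]
    intro a
    rw [eventually_map]
    have h0 : Tendsto (fun j => (n j : ℝ) * ξ j - a * ξ j) atTop (𝓝 (-minNorm R N / s - a * 0)) :=
      hnξ.sub (hξ0.const_mul _)
    rw [mul_zero, sub_zero] at h0
    filter_upwards [h0.eventually_ne hne] with j hj e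
    exact hj (by rw [e, sub_self])
  have habs : Tendsto (fun j => |(n j : ℝ)| * |ξ j|) atTop (𝓝 (minNorm R N / s)) := by
    have := hnξ.abs
    rw [neg_div, abs_neg, abs_of_pos (by positivity)] at this
    exact this.congr fun j => abs_mul _ _
  have lim' := (continuous_coe_real_ereal.tendsto _).comp habs
  rw [← lim'.liminf_eq, inhomConst]
  refine (liminf_le_liminf_of_le hcof).trans ?_
  rw [← liminf_comp]
  refine liminf_le_liminf (Eventually.of_forall fun j => EReal.coe_le_coe_iff.mpr ?_)
  exact mul_le_mul_of_nonneg_left (round_le _ _) (abs_nonneg _)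

lemma IsSharpPair.inhomConst_eq {R N : ℕ} {α γ : ℝ} (hodd : Odd R) (hR : 3 ≤ R) (hN : 1 ≤ N)
    (h : IsSharpPair R N α γ) :
    inhomConst α γ = ((minNorm R N / (N * R - 2 * α) : ℝ) : EReal) := by
  have hquad := (h.expansion.negTail_alt hR hN).1
  rw [h.gamma_eq hR hN]
  exact le_antisymm (inhomConst_le hodd hR hN h.expansion.mem hquad)
    (le_inhomConst hodd hR hN h.expansion.mem hquad)

lemma IsSharpPair.not_inIntSpan {R N : ℕ} {α γ : ℝ} (hodd : Odd R) (hR : 3 ≤ R) (hN : 1 ≤ N)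
    (h : IsSharpPair R N α γ) : ¬ InIntSpan α γ := by
  rintro ⟨m, n, hγ⟩
  have hquad := (h.expansion.negTail_alt hR hN).1
  have hle := minNorm_le hodd hR hN h.expansion.mem hquad (k := 2 * n + 1) (q := 2 * (-m) + 1)
    ⟨n, rfl⟩ ⟨-m, rfl⟩
  have h0 : cosetElt R N α (2 * n + 1) (2 * (-m) + 1) = 0 := by
    rw [cosetElt_eq, ← h.gamma_eq hR hN, hγ]; push_cast; ring
  rw [h0, zero_mul, abs_zero] at hle
  exact (minNorm_pos (by exact_mod_cast hR) (by exact_mod_cast hN)).not_ge hle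

/-! ### The limit and the sharpness of the bound -/

lemma tendsto_minNorm_div {R : ℕ} (hR : 3 ≤ R) {α : ℕ → ℝ}
    (hα : ∀ N, 1 ≤ N → α N ∈ Set.Ioo (0 : ℝ) 1) :
    Tendsto (fun N : ℕ => minNorm R N / (N * R - 2 * α N)) atTop (𝓝 (oddBound R)) := by
  have h1 : (3 : ℝ) ≤ R := by exact_mod_cast hR
  have hinv : Tendsto (fun N : ℕ => 1 / (N : ℝ)) atTop (𝓝 0) := tendsto_one_div_atTop_nhds_zero_nat
  have hsmall : Tendsto (fun N : ℕ => 2 * α N * (1 / (N : ℝ))) atTop (𝓝 0) := by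
    refine squeeze_zero' (g := fun N : ℕ => 2 * (1 / (N : ℝ))) ?_ ?_
      (by simpa using hinv.const_mul 2)
    · filter_upwards [eventually_ge_atTop 1] with N hN
      have := (hα N hN).1
      positivity
    · filter_upwards [eventually_ge_atTop 1] with N hN
      gcongr
      linarith [(hα N hN).2]
  have hconst : Tendsto (fun N : ℕ => ((R : ℝ) - 1 - 1 / (N : ℝ)) / ((R : ℝ) ^ 2 - 4 * (1 / (N : ℝ)))) atTop
      (𝓝 (((R : ℝ) - 1 - 0) / ((R : ℝ) ^ 2 - 4 * 0))) :=
    (tendsto_const_nhds.sub hinv).div (tendsto_const_nhds.sub (hinv.const_mul 4))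
      (by simp only [sub_zero, mul_zero]; positivity)
  have lim := (((tendsto_const_nhds (x := (R : ℝ) - 1)).sub hinv).sub hconst).div
    ((tendsto_const_nhds (x := (4 : ℝ))).mul
      ((tendsto_const_nhds (x := (R : ℝ))).sub hsmall)) (by simp only [sub_zero]; positivity)
  have hval : ((R : ℝ) - 1 - 0 - (R - 1 - 0) / (R ^ 2 - 4 * 0)) / (4 * (R - 0)) = oddBound R := by
    unfold oddBound
    have : (R : ℝ) ≠ 0 := by positivity
    simp only [sub_zero, mul_zero]
    field_simp
  rw [hval] at lim
  refine lim.congr' ?_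
  filter_upwards [eventually_ge_atTop 1] with N hN
  have h2 : (1 : ℝ) ≤ N := by exact_mod_cast hN
  have hN0 : (N : ℝ) ≠ 0 := by positivity
  have hs := denom_pos hR hN (hα N hN)
  have e1 : (R : ℝ) - 2 * α N * (1 / N) = (N * R - 2 * α N) / N := by field_simp
  have e2 : ((R : ℝ) - 1 - 1 / N) / (R ^ 2 - 4 * (1 / N)) = quadConst R N := by
    rw [quadConst, ← mul_div_mul_left _ _ hN0]
    congr 1 <;> field_simp
  rw [Pi.div_apply, e1, e2, minNorm]
  field_simp

lemma liminf_negDigit {R N : ℕ} {α : ℝ} (hN : 1 ≤ N)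
    (h : HasNegExpansion α (altSeq R (N * R))) :
    liminf (fun i => (((negDigit α i : ℤ) : ℝ) : EReal)) atTop = (((R : ℕ) : ℝ) : EReal) := by
  apply le_antisymm
  · refine liminf_le_of_frequently_le ?_
    refine frequently_atTop.mpr fun i => ⟨2 * i, by omega, ?_⟩
    rw [h.digit, altSeq_even]; simp
  · refine le_liminf_of_le (by isBoundedDefault) (Eventually.of_forall fun i => ?_)
    rw [h.digit, EReal.coe_le_coe_iff]
    have : (R : ℤ) ≤ altSeq R (N * R) i := by
      unfold altSeq; split_ifs
      · exact le_rfl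
      · exact_mod_cast Nat.le_mul_of_pos_left R hN
    exact_mod_cast this

theorem theorem2 (R : ℕ) (hodd : Odd R) (hR : 3 ≤ R) :
    -- for every `N ≥ 1` the numbers `α` and `γ_*` exist, and `γ_*` is an admissible `γ`
    (∀ N : ℕ, 1 ≤ N → ∃ α γ : ℝ,
      IsSharpPair R N α γ ∧ γ ∈ Set.Ioo (0 : ℝ) 1 ∧ ¬ InIntSpan α γ) ∧
    -- their approximation constants tend to `C(R)`
    (∀ α γ : ℕ → ℝ, (∀ N : ℕ, 1 ≤ N → IsSharpPair R N (α N) (γ N)) →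
      Tendsto (fun N => inhomConst (α N) (γ N)) atTop (𝓝 ((oddBound R : ℝ) : EReal))) ∧
    -- hence `C(R)` cannot be replaced by a smaller bound for the `α` with `liminf a_i = R`
    (∀ c : ℝ,
      (∀ α : ℝ, Irrational α → α ∈ Set.Ioo (0 : ℝ) 1 →
        liminf (fun i => (((negDigit α i : ℤ) : ℝ) : EReal)) atTop = (((R : ℕ) : ℝ) : EReal) →
        worstConst α ≤ (c : EReal)) →
      oddBound R ≤ c) := by
  have lim : ∀ α γ : ℕ → ℝ, (∀ N : ℕ, 1 ≤ N → IsSharpPair R N (α N) (γ N)) →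
      Tendsto (fun N => inhomConst (α N) (γ N)) atTop (𝓝 ((oddBound R : ℝ) : EReal)) := by
    intro α γ h
    refine ((continuous_coe_real_ereal.tendsto _).comp
      (tendsto_minNorm_div hR fun N hN => (h N hN).expansion.mem)).congr' ?_
    filter_upwards [eventually_ge_atTop 1] with N hN
    exact ((h N hN).inhomConst_eq hodd hR hN).symm
  refine ⟨fun N hN => ?_, lim, fun c hc => ?_⟩
  · obtain ⟨α, γ, h⟩ := exists_isSharpPair hodd hR hN
    refine ⟨α, γ, h, ?_, h.not_inIntSpan hodd hR hN⟩
    rw [h.gamma_eq hR hN]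
    exact gamma_mem hR hN h.expansion.mem (h.expansion.negTail_alt hR hN).1
  · have hex : ∀ N : ℕ, ∃ α γ : ℝ, 1 ≤ N → IsSharpPair R N α γ := fun N => by
      by_cases hN : 1 ≤ N
      · obtain ⟨α, γ, h⟩ := exists_isSharpPair hodd hR hN
        exact ⟨α, γ, fun _ => h⟩
      · exact ⟨0, 0, fun h => absurd h hN⟩
    choose α γ h using hex
    rw [← EReal.coe_le_coe_iff]
    refine le_of_tendsto (lim α γ h) ?_
    filter_upwards [eventually_ge_atTop 1] with N hN
    have hs := h N hN
    refine le_trans ?_ (hc (α N) hs.expansion.irrational hs.expansion.mem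
      (liminf_negDigit hN hs.expansion))
    exact le_iSup₂_of_le (γ N) (hs.not_inIntSpan hodd hR hN) le_rfl
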